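/- A (left) brace $(A,+,\circ)$ is a set with an abelian group structure $(A,+)$ and a group structure $(A,\circ)$ such that $a\circ(b+c)+a=a\circ b+a\circ c$ for all $a,b,c\in A$; one writes $a*b=a\circ b-a-b$. An ideal of $A$ is an additive subgroup $I$ with $i*a,\ a*i\in I$ for all $i\in I$, $a\in A$; then $I$ is itself a brace, and the factor group $A/I$ is a brace with $[a]\circ[b]=[a\circ b]$, where $[a]=a+I$. For a natural number $m$ and an abelian group $A$ put $mA=\{ma:a\in A\}$ and $\mathrm{ann}(m)=\{a\in A: ma=0\}$. A pullback function for $m$ on $A$ is any function $\phi:mA\to A$ with $m\,\phi(x)=x$ for all $x\in mA$. **Theorem.** Let $p$ be a prime, let $n,k\ge 0$ be integers, and let $(A,+)$ be an abelian group of order $p^n$. There is a formal expression $q$ in two variables, built from a binary symbol $+$, a binary symbol $\odot$ and a unary symbol $\rho^{-1}$, and depending only on $p,n,k$ and the additive group $(A,+)$, such that the following holds for every brace $(A,+,\circ)$ with this additive group. Suppose that for some integer $0\le m<\frac{p-1}{4}$ we have, for all $a,b\in A$ and all $i\ge 1$, $$\underbrace{a*(a*(\cdots *(a}_{m}*\,b)\cdots))\in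 pA,\qquad \underbrace{a*(a*(\cdots *(a}_{m}*\,c)\cdots))\in \mathrm{ann}(p^{i-1})\ \text{ for all } c\in \mathrm{ann}(p^i).$$ Then: 1. $\mathrm{ann}(p^{2k})$ and $p^kA$ are ideals of $A$, so that the factor brace $A/\mathrm{ann}(p^{2k})$ and the brace $p^kA$ are defined. Write $[a]=a+\mathrm{ann}(p^{2k})$. 2. For all $x,y\in A$ one has $(p^kx)*y\in p^kA$, and $[x]\odot[y]=[\wp^{-1}((p^kx)*y)]$ is a well-defined binary operation on $A/\mathrm{ann}(p^{2k})$, independent of the choice of the pullback function $\wp^{-1}$ for $p^k$ on $A$. It is determined by the brace $p^kA$ and the group $(A,+)$: one has $(p^kx)*(p^ky)\in p^{2k}A$ and $[x]\odot[y]=[w((p^kx)*(p^ky))]$ for every pullback function $w$ for $p^{2k}$ on $A$. 3. For every pullback function $\rho^{-1}$ for $p$ on $A/\mathrm{ann}(p^{2k})$ and all $a,b\in A$, the expression $q$ can be evaluated at $([a],[b])$ with $+$, $\odot$ and $\rho^{-1}$ in $A/\mathrm{ann}(p^{2k})$ (that is, $\rho^{-1}$ is only ever applied to elements of $p\,(A/\mathrm{ann}(p^{2k}))$),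 and its value is $[a]*[b]$. In particular the value does not depend on the choice of $\rho^{-1}$. -/

import Mathlib

/-- A (left) brace structure on the abelian group `(A, +)`: a group structure `(A, ∘)`, whose
multiplication is `circ` below, such that `a ∘ (b + c) + a = a ∘ b + a ∘ c`. -/
structure LeftBrace (A : Type*) [AddCommGroup A] extends Group A where
  mul_add_add : ∀ a b c : A, mul a (b + c) + a = mul a b + mul a c

namespace LeftBrace

variable {A : Type*} [AddCommGroup A]

/-- The operation `a ∘ b` of a brace. -/
def circ (B : LeftBrace A) (a b : A) : A := B.mul a b

/-- The operation `a * b = a ∘ b - a - b` of a brace. -/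
def star (B : LeftBrace A) (a b : A) : A := B.circ a b - a - b

/-- The inverse in the group `(A, ∘)`. -/
def cinv (B : LeftBrace A) (a : A) : A := B.inv a

theorem circ_eq (B : LeftBrace A) (a b : A) : B.circ a b = a + b + B.star a b := by
  unfold star; abel

theorem circ_add (B : LeftBrace A) (a b c : A) :
    B.circ a (b + c) = B.circ a b + B.circ a c - a :=
  eq_sub_of_add_eq (B.mul_add_add a b c)

theorem circ_zero (B : LeftBrace A) (a : A) : B.circ a 0 = a := by
  have h := B.circ_add a 0 0
  rw [add_zero, eq_sub_iff_add_eq] at h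
  exact (add_left_cancel h).symm

theorem circ_assoc (B : LeftBrace A) (a b c : A) :
    B.circ (B.circ a b) c = B.circ a (B.circ b c) :=
  let _ := B.toGroup; mul_assoc a b c

theorem zero_circ (B : LeftBrace A) (a : A) : B.circ 0 a = a := by
  let _ := B.toGroup
  have h : (1 : A) = 0 := (B.circ_zero 1).symm.trans (one_mul (0 : A))
  calc B.circ 0 a = B.circ 1 a := by rw [h]
    _ = a := one_mul a

theorem cinv_circ (B : LeftBrace A) (a : A) : B.circ (B.cinv a) a = 0 := by
  let _ := B.toGroup
  have h : (1 : A) = 0 := (B.circ_zero 1).symm.trans (one_mul (0 : A))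
  exact (inv_mul_cancel a).trans h

theorem circ_cinv (B : LeftBrace A) (a : A) : B.circ a (B.cinv a) = 0 := by
  let _ := B.toGroup
  have h : (1 : A) = 0 := (B.circ_zero 1).symm.trans (one_mul (0 : A))
  exact (mul_inv_cancel a).trans h

/-- Build a brace from an operation `∘` that has `0` as a left identity and left inverses. -/
def ofCirc (op : A → A → A) (iv : A → A) (hassoc : ∀ a b c, op (op a b) c = op a (op b c))
    (hzero : ∀ a, op 0 a = a) (hinv : ∀ a, op (iv a) a = 0)
    (hadd : ∀ a b c, op a (b + c) + a = op a b + op a c) : LeftBrace A :=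
  { @Group.ofLeftAxioms A ⟨op⟩ ⟨iv⟩ ⟨0⟩ hassoc hzero hinv with
    mul_add_add := hadd }

/-- `I` is an ideal of the brace: an additive subgroup with `i * a ∈ I` and `a * i ∈ I` for all
`i ∈ I` and `a ∈ A`. -/
def IsIdeal (B : LeftBrace A) (I : AddSubgroup A) : Prop :=
  ∀ i ∈ I, ∀ a : A, B.star i a ∈ I ∧ B.star a i ∈ I

variable {B : LeftBrace A} {I : AddSubgroup A}

theorem IsIdeal.circ_mem (h : B.IsIdeal I) {a b : A} (ha : a ∈ I) (hb : b ∈ I) :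
    B.circ a b ∈ I := by
  rw [B.circ_eq]
  exact I.add_mem (I.add_mem ha hb) (h a ha b).1

theorem IsIdeal.cinv_mem (h : B.IsIdeal I) {a : A} (ha : a ∈ I) : B.cinv a ∈ I := by
  have h1 := B.circ_eq a (B.cinv a)
  rw [B.circ_cinv] at h1
  have h2 : B.cinv a = -a - B.star a (B.cinv a) := by
    rw [← sub_eq_zero]
    calc _ = a + B.cinv a + B.star a (B.cinv a) := by abel
      _ = 0 := h1.symm
  rw [h2]
  exact I.sub_mem (I.neg_mem ha) (h a ha _).1

/-- Elements congruent modulo an ideal differ by a right `∘`-factor from the ideal. -/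
theorem IsIdeal.exists_circ (h : B.IsIdeal I) {a b : A} (hab : -a + b ∈ I) :
    ∃ i ∈ I, b = B.circ a i := by
  refine ⟨B.circ (B.cinv a) b, ?_, ?_⟩
  · have h1 : B.circ (B.cinv a) b = (-a + b) + B.star (B.cinv a) (-a + b) := by
      have h2 : b = a + (-a + b) := by abel
      conv_lhs => rw [h2, B.circ_add, B.cinv_circ, B.circ_eq]
      abel
    rw [h1]
    exact I.add_mem hab (h _ hab _).2
  · rw [← B.circ_assoc, B.circ_cinv, B.zero_circ]

theorem IsIdeal.circ_congr (h : B.IsIdeal I) {a a' b b' : A} (ha : -a + a' ∈ I)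
    (hb : -b + b' ∈ I) : -(B.circ a b) + B.circ a' b' ∈ I := by
  obtain ⟨i, hi, rfl⟩ := h.exists_circ ha
  have h1 : -b + B.circ i b' ∈ I := by
    rw [B.circ_eq]
    have : -b + (i + b' + B.star i b') = (-b + b') + i + B.star i b' := by abel
    rw [this]
    exact I.add_mem (I.add_mem hb hi) (h i hi _).1
  have h2 : -(B.circ a b) + B.circ (B.circ a i) b' =
      (-b + B.circ i b') + B.star a (-b + B.circ i b') := by
    rw [B.circ_assoc]
    have h3 : B.circ i b' = b + (-b + B.circ i b') := by abel
    conv_lhs => rw [h3, B.circ_add, B.circ_eq a (-b + B.circ i b')]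
    abel
  rw [h2]
  exact I.add_mem h1 (h _ h1 _).2

theorem IsIdeal.cinv_congr (h : B.IsIdeal I) {a a' : A} (ha : -a + a' ∈ I) :
    -(B.cinv a) + B.cinv a' ∈ I := by
  have h0 : -(B.cinv a') + B.cinv a' ∈ I := by simp
  have h1 := h.circ_congr h0 ha
  have h2 : -(B.cinv a) + B.cinv a ∈ I := by simp
  have h3 := h.circ_congr h1 h2
  rw [B.circ_assoc, B.circ_cinv, B.circ_zero, B.cinv_circ, B.zero_circ] at h3
  have h4 := I.neg_mem h3
  have h5 : -(-(B.cinv a') + B.cinv a) = -(B.cinv a) + B.cinv a' := by abel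
  rwa [h5] at h4

/-- The factor brace `A / I` on the additive factor group, with `[a] ∘ [b] = [a ∘ b]`. -/
def factor (B : LeftBrace A) (I : AddSubgroup A) (h : B.IsIdeal I) : LeftBrace (A ⧸ I) :=
  ofCirc
    (Quotient.map₂ B.circ fun _ _ ha _ _ hb => QuotientAddGroup.leftRel_apply.mpr
      (h.circ_congr (QuotientAddGroup.leftRel_apply.mp ha) (QuotientAddGroup.leftRel_apply.mp hb)))
    (Quotient.map B.cinv fun _ _ ha => QuotientAddGroup.leftRel_apply.mpr
      (h.cinv_congr (QuotientAddGroup.leftRel_apply.mp ha)))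
    (by
      rintro ⟨a⟩ ⟨b⟩ ⟨c⟩
      exact congrArg (QuotientAddGroup.mk (s := I)) (B.circ_assoc a b c))
    (by
      rintro ⟨a⟩
      exact congrArg (QuotientAddGroup.mk (s := I)) (B.zero_circ a))
    (by
      rintro ⟨a⟩
      exact congrArg (QuotientAddGroup.mk (s := I)) (B.cinv_circ a))
    (by
      rintro ⟨a⟩ ⟨b⟩ ⟨c⟩
      exact congrArg (QuotientAddGroup.mk (s := I)) (B.mul_add_add a b c))

theorem factor_circ_mk (B : LeftBrace A) (I : AddSubgroup A) (h : B.IsIdeal I) (a b : A) :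
    (B.factor I h).circ (a : A ⧸ I) (b : A ⧸ I) = ((B.circ a b : A) : A ⧸ I) := rfl

theorem factor_star_mk (B : LeftBrace A) (I : AddSubgroup A) (h : B.IsIdeal I) (a b : A) :
    (B.factor I h).star (a : A ⧸ I) (b : A ⧸ I) = ((B.star a b : A) : A ⧸ I) := rfl

/-- An ideal `I`, regarded as a brace with the operations of `A`. -/
def restrict (B : LeftBrace A) (I : AddSubgroup A) (h : B.IsIdeal I) : LeftBrace I :=
  ofCirc (fun a b => ⟨B.circ a b, h.circ_mem a.2 b.2⟩) (fun a => ⟨B.cinv a, h.cinv_mem a.2⟩)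
    (fun a b c => Subtype.ext (B.circ_assoc a b c))
    (fun a => Subtype.ext (B.zero_circ a))
    (fun a => Subtype.ext (B.cinv_circ a))
    (fun a b c => Subtype.ext (B.mul_add_add a b c))

theorem coe_restrict_circ (B : LeftBrace A) (I : AddSubgroup A) (h : B.IsIdeal I) (a b : I) :
    ((B.restrict I h).circ a b : A) = B.circ a b := rfl

theorem coe_restrict_star (B : LeftBrace A) (I : AddSubgroup A) (h : B.IsIdeal I) (a b : I) :
    ((B.restrict I h).star a b : A) = B.star a b := rfl

end LeftBrace

/-- The subgroup `mA = {m a : a ∈ A}` of an abelian group. -/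
def multiples (A : Type*) [AddCommGroup A] (m : ℕ) : AddSubgroup A where
  carrier := {x | ∃ a : A, m • a = x}
  add_mem' := by
    rintro _ _ ⟨a, rfl⟩ ⟨b, rfl⟩
    exact ⟨a + b, smul_add m a b⟩
  zero_mem' := ⟨0, smul_zero m⟩
  neg_mem' := by
    rintro _ ⟨a, rfl⟩
    exact ⟨-a, smul_neg m a⟩

/-- The element `m a` of `mA`. -/
def multiple {A : Type*} [AddCommGroup A] (m : ℕ) (a : A) : multiples A m := ⟨m • a, a, rfl⟩

/-- The subgroup `ann(m) = {a ∈ A : m a = 0}` of an abelian group. -/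
def annihilated (A : Type*) [AddCommGroup A] (m : ℕ) : AddSubgroup A where
  carrier := {a | m • a = 0}
  add_mem' := by
    intro a b ha hb
    simp only [Set.mem_ofPred_eq] at ha hb ⊢
    rw [smul_add, ha, hb, add_zero]
  zero_mem' := smul_zero m
  neg_mem' := by
    intro a ha
    simp only [Set.mem_ofPred_eq] at ha ⊢
    rw [smul_neg, ha, neg_zero]

/-- A pullback function for multiplication by `m`: a function `mA → A`, not assumed to be additive,
which picks for every `x ∈ mA` an element `y ∈ A` with `m y = x`. -/
structure Pullback (A : Type*) [AddCommGroup A] (m : ℕ) where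
  toFun : multiples A m → A
  smul_toFun : ∀ x : multiples A m, m • toFun x = (x : A)

/-- Formal algebraic expressions in two variables, built with a binary sum, a further binary
operation `⊙` and a unary symbol `ρ⁻¹`. -/
inductive BraceFormula : Type
  | fst : BraceFormula
  | snd : BraceFormula
  | add : BraceFormula → BraceFormula → BraceFormula
  | odot : BraceFormula → BraceFormula → BraceFormula
  | pull : BraceFormula → BraceFormula

open Classical in
/-- The value of an expression at `x`, `y` in an abelian group `G` with a binary operation `op`
for `⊙` and a pullback function `ρ : pG → G` for `ρ⁻¹`. The value is `none` as soon as `ρ⁻¹`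
would have to be applied to an element outside of `pG`. -/
noncomputable def BraceFormula.eval {G : Type*} [AddCommGroup G] {p : ℕ} (op : G → G → G)
    (ρ : Pullback G p) (x y : G) : BraceFormula → Option G
  | .fst => some x
  | .snd => some y
  | .add s t => (s.eval op ρ x y).bind fun u => (t.eval op ρ x y).map fun v => u + v
  | .odot s t => (s.eval op ρ x y).bind fun u => (t.eval op ρ x y).map fun v => op u v
  | .pull t => (t.eval op ρ x y).bind fun u =>
      if h : u ∈ multiples G p then some (ρ.toFun ⟨u, h⟩) else none

namespace LeftBrace

variable {A : Type*} [AddCommGroup A]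

/-- For some number `m < (p - 1) / 4` of factors `a`, all products `a * (a * (⋯ * (a * b)))` lie in
`pA`, and they lie in `ann(p^(i-1))` whenever `b ∈ ann(p^i)`, `i ≥ 1`. -/
def HasShortProducts (B : LeftBrace A) (p : ℕ) : Prop :=
  ∃ m : ℕ, (m : ℚ) < ((p : ℚ) - 1) / 4 ∧
    (∀ a b : A, (B.star a)^[m] b ∈ multiples A p) ∧
    ∀ i : ℕ, 1 ≤ i → ∀ a : A, ∀ b ∈ annihilated A (p ^ i),
      (B.star a)^[m] b ∈ annihilated A (p ^ (i - 1))

/-- `op` is the operation `[x] ⊙ [y] = [℘⁻¹((p^k x) * y)]` on `A / ann(p^(2k))`, for every pullback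
function `℘⁻¹ : p^k A → A`; in particular `(p^k x) * y` always lies in `p^k A`, and the right-hand
side depends neither on the representatives `x`, `y` nor on the choice of `℘⁻¹`. -/
def IsOdot (B : LeftBrace A) (p k : ℕ)
    (op : A ⧸ annihilated A (p ^ (2 * k)) → A ⧸ annihilated A (p ^ (2 * k)) →
      A ⧸ annihilated A (p ^ (2 * k))) : Prop :=
  ∀ (w : Pullback A (p ^ k)) (x y : A),
    ∃ h : B.star (p ^ k • x) y ∈ multiples A (p ^ k),
      op (x : A ⧸ annihilated A (p ^ (2 * k))) (y : A ⧸ annihilated A (p ^ (2 * k))) =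
        ((w.toFun ⟨_, h⟩ : A) : A ⧸ annihilated A (p ^ (2 * k)))

/-- `op` is given on `A / ann(p^(2k))` by a brace `C` with additive group `p^k A` through
`[x] ⊙ [y] = [w((p^k x) * (p^k y))]`, where `*` is taken in `C` and `w : p^(2k) A → A` is any
pullback function for multiplication by `p^(2k)`. Only `(A, +)` and `C` enter. -/
def IsOdotOfMultiples (p k : ℕ) (C : LeftBrace (multiples A (p ^ k)))
    (op : A ⧸ annihilated A (p ^ (2 * k)) → A ⧸ annihilated A (p ^ (2 * k)) →
      A ⧸ annihilated A (p ^ (2 * k))) : Prop :=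
  ∀ (w : Pullback A (p ^ (2 * k))) (x y : A),
    ∃ h : (C.star (multiple (p ^ k) x) (multiple (p ^ k) y) : A) ∈ multiples A (p ^ (2 * k)),
      op (x : A ⧸ annihilated A (p ^ (2 * k))) (y : A ⧸ annihilated A (p ^ (2 * k))) =
        ((w.toFun ⟨_, h⟩ : A) : A ⧸ annihilated A (p ^ (2 * k)))

end LeftBrace

/-!
Write `L y = a * y`, so that `1 + L` is the action of `a` on `(A, +)`. The hypothesis says that some
power `L ^ m` with `2 * m ≤ p - 1` maps into `pA` and kills the `p`-torsion (and the same holds on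
the factor groups by `ann(p ^ i)`). Hence there is a well-defined endomorphism
`D = L ^ (2 * m) / p = L ^ m ∘ p⁻¹ ∘ L ^ m`, and polynomials in two variables `X`, `D` can be
evaluated at `L` (`IsShort.eval`), consistently with the relation `p D = X ^ (2 * m)`.

*Powers.* Modulo this relation, `((1 + X) ^ (p ^ k) - 1) / X` is `p ^ k U` for a polynomial `U` with
constant term `1` (`exists_isPowPoly`). Consequently the `p ^ k`-th power of `a` in `(A, ∘)` is
`p ^ k U(L) a`, and it acts as `1 + p ^ k L U(L)` (`cpow_eq_smul_eval`, `star_cpow`). As `U(L)` is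
invertible, `ann(p ^ k)` is the set of elements with trivial `p ^ k`-th power, so it is an ideal.

*Recovering `L`.* The substitution `X ↦ X U`, `D ↦ D U ^ (2 * m)` is the identity to first order at
the origin, so it is onto modulo any power of `(X, D)` (`exists_substHom_sub_mem`), and high powers
of `(X, D)` evaluate to `0`. Thus `L` and `U(L)⁻¹` are universal polynomials in `E = L U(L)` and
`E ^ (2 * m) / p`. In particular the power of `a` determines `a` modulo `ann(p ^ k)`, and since `A`
is finite every element of `p ^ k A` is a `p ^ k`-th power. It follows that `p ^ k A` is an ideal,
and that `⊙` is well defined, with `g ⊙ y = E y` for `g = U(L) a`.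

*The formula.* On the factor group, `g ↦ a` is given by `a = U(L)⁻¹ g`, a polynomial in the operation
`g ⊙ _`; this is expressible because the division in `E ^ m ∘ p⁻¹ ∘ E ^ m` is insensitive to the
choice of the pullback function. The map `a ↦ g` is the inverse of this permutation of a finite set,
that is, an iterate of it with an exponent depending only on the size of the set. Finally
`a * b = L b` is a polynomial in the operation `g ⊙ _` applied to `b` (`IsExpressible.of_eval_odot`).
-/

/-! ### Endomorphisms with a divisible power -/

/-- The `m`-th power of the endomorphism `L` is divisible by `p`: it maps into `pM` and kills the
`p`-torsion. -/
structure IsShort {M : Type*} [AddCommGroup M] (p m : ℕ) (L : Module.End ℤ M) : Prop where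
  exists_smul_eq : ∀ y, ∃ z, p • z = (L ^ m) y
  pow_apply_eq_zero : ∀ y, p • y = 0 → (L ^ m) y = 0

/-- Two commuting elements of a ring can be substituted into integer polynomials. -/
theorem exists_ringHom_of_commute {R : Type*} [Ring R] {x y : R} (h : Commute x y) :
    ∃ φ : MvPolynomial (Fin 2) ℤ →+* R, φ (.X 0) = x ∧ φ (.X 1) = y := by
  let φ : Polynomial ℤ →+* R :=
    Polynomial.eval₂RingHom' (Int.castRingHom R) x fun n => Int.cast_commute n x
  let ψ : Polynomial (Polynomial ℤ) →+* R := Polynomial.eval₂RingHom' φ y fun f => by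
    induction f using Polynomial.induction_on' with
    | add f g hf hg => rw [map_add]; exact hf.add_left hg
    | monomial n c =>
      have : φ (Polynomial.monomial n c) = (c : R) * x ^ n := by
        simp [φ, Polynomial.eval₂RingHom', Polynomial.eval₂_monomial]
      rw [this]
      exact (Int.cast_commute c y).mul_left (h.pow_left n)
  refine ⟨ψ.comp (MvPolynomial.eval₂Hom (Int.castRingHom _)
    ![Polynomial.C Polynomial.X, Polynomial.X]), ?_, ?_⟩
  · simp [ψ, φ, Polynomial.eval₂RingHom']
  · simp [ψ, Polynomial.eval₂RingHom']

namespace IsShort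

variable {M M' : Type*} [AddCommGroup M] [AddCommGroup M'] {p m : ℕ}
  {L L₁ L₂ : Module.End ℤ M} {L' : Module.End ℤ M'}

theorem pow_apply_congr (h : IsShort p m L) {y z : M} (hyz : p • y = p • z) :
    (L ^ m) y = (L ^ m) z := by
  rw [← sub_eq_zero, ← map_sub]
  exact h.pow_apply_eq_zero _ (by rw [smul_sub, hyz, sub_self])

/-- The endomorphism `L ^ (2 * m) / p`, obtained by dividing by `p` in the middle of `2 * m`
applications of `L`: the first `m` make the division possible, the last `m` make it unique. -/
noncomputable def quot (h : IsShort p m L) : Module.End ℤ M :=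
  AddMonoidHom.toIntLinearMap <| AddMonoidHom.mk'
    (fun y => (L ^ m) (h.exists_smul_eq y).choose) fun y z => by
      rw [← map_add]
      refine h.pow_apply_congr ?_
      rw [smul_add, (h.exists_smul_eq y).choose_spec, (h.exists_smul_eq z).choose_spec,
        (h.exists_smul_eq (y + z)).choose_spec, map_add]

theorem quot_apply (h : IsShort p m L) {y z : M} (hz : p • z = (L ^ m) y) :
    h.quot y = (L ^ m) z :=
  h.pow_apply_congr ((h.exists_smul_eq y).choose_spec.trans hz.symm)

theorem smul_quot (h : IsShort p m L) (y : M) : p • h.quot y = (L ^ (2 * m)) y := by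
  obtain ⟨z, hz⟩ := h.exists_smul_eq y
  rw [h.quot_apply hz, ← map_nsmul, hz, two_mul, pow_add, Module.End.mul_apply]

theorem map_pow_apply {f : M →ₗ[ℤ] M'} (hf : ∀ y, f (L y) = L' (f y)) (i : ℕ) (y : M) :
    f ((L ^ i) y) = (L' ^ i) (f y) := by
  induction i generalizing y with
  | zero => rfl
  | succ i ih => rw [pow_succ, pow_succ, Module.End.mul_apply, Module.End.mul_apply, ih, hf]

theorem map_quot (h : IsShort p m L) (h' : IsShort p m L') {f : M →ₗ[ℤ] M'}
    (hf : ∀ y, f (L y) = L' (f y)) (y : M) : f (h.quot y) = h'.quot (f y) := by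
  obtain ⟨z, hz⟩ := h.exists_smul_eq y
  have hz' : p • f z = (L' ^ m) (f y) := by rw [← map_nsmul, hz, map_pow_apply hf]
  rw [h.quot_apply hz, h'.quot_apply hz', map_pow_apply hf]

theorem commute_quot (h : IsShort p m L) : Commute L h.quot :=
  LinearMap.ext fun y => h.map_quot h (f := L) (fun _ => rfl) y

/-- Evaluation of polynomials in two variables `X`, `D` at `L` and `L ^ (2 * m) / p`. -/
noncomputable def eval (h : IsShort p m L) : MvPolynomial (Fin 2) ℤ →+* Module.End ℤ M :=
  (exists_ringHom_of_commute h.commute_quot).choose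

@[simp]
theorem eval_X_zero (h : IsShort p m L) : h.eval (.X 0) = L :=
  (exists_ringHom_of_commute h.commute_quot).choose_spec.1

@[simp]
theorem eval_X_one (h : IsShort p m L) : h.eval (.X 1) = h.quot :=
  (exists_ringHom_of_commute h.commute_quot).choose_spec.2

theorem eval_congr (h₁ : IsShort p m L₁) (h₂ : IsShort p m L₂) (h : L₁ = L₂) :
    h₁.eval = h₂.eval := by
  subst h; rfl

theorem map_eval (h : IsShort p m L) (h' : IsShort p m L') {f : M →ₗ[ℤ] M'}
    (hf : ∀ y, f (L y) = L' (f y)) (F : MvPolynomial (Fin 2) ℤ) (y : M) :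
    f (h.eval F y) = h'.eval F (f y) := by
  induction F using MvPolynomial.induction_on generalizing y with
  | C c =>
    rw [← MvPolynomial.algebraMap_eq, eq_intCast, map_intCast, map_intCast]
    simp
  | add F G hF hG => simp only [map_add, LinearMap.add_apply, hF, hG]
  | mul_X F i hF =>
    rw [map_mul, map_mul, Module.End.mul_apply, Module.End.mul_apply, hF]
    congr 1
    fin_cases i
    · simpa using hf y
    · simpa using h.map_quot h' hf y

theorem eval_mul_comm (h : IsShort p m L) (F G : MvPolynomial (Fin 2) ℤ) (y : M) :
    h.eval F (h.eval G y) = h.eval G (h.eval F y) := by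
  rw [← Module.End.mul_apply, ← Module.End.mul_apply, ← map_mul, ← map_mul, mul_comm]

/-- The relation `p D = X ^ (2 * m)` holds for the endomorphisms substituted for `X` and `D`. -/
theorem eval_eq_of_sub_mem (h : IsShort p m L) {F G : MvPolynomial (Fin 2) ℤ}
    (hFG : F - G ∈ Ideal.span {(p : MvPolynomial (Fin 2) ℤ) * .X 1 - .X 0 ^ (2 * m)}) :
    h.eval F = h.eval G := by
  obtain ⟨H, hH⟩ := Ideal.mem_span_singleton'.mp hFG
  rw [← sub_eq_zero, ← map_sub, ← hH, map_mul]
  have : h.eval ((p : MvPolynomial (Fin 2) ℤ) * .X 1 - .X 0 ^ (2 * m)) = 0 := by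
    refine LinearMap.ext fun y => ?_
    simp [h.smul_quot]
  rw [this, mul_zero]

theorem exists_smul_eq_pow (h : IsShort p m L) (i : ℕ) (y : M) :
    ∃ z, p ^ i • z = (L ^ (m * i)) y := by
  induction i with
  | zero => exact ⟨y, by simp⟩
  | succ i ih =>
    obtain ⟨z, hz⟩ := ih
    obtain ⟨w, hw⟩ := h.exists_smul_eq z
    refine ⟨w, ?_⟩
    rw [pow_succ, mul_smul, hw, ← map_nsmul, hz, mul_add, mul_one, add_comm, pow_add,
      Module.End.mul_apply]

theorem exists_smul_eq_quot_pow (h : IsShort p m L) (i : ℕ) (y : M) :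
    ∃ z, p ^ i • z = (h.quot ^ i) y := by
  induction i with
  | zero => exact ⟨y, by simp⟩
  | succ i ih =>
    obtain ⟨z, hz⟩ := ih
    obtain ⟨w, hw⟩ := h.exists_smul_eq z
    obtain ⟨v, hv⟩ := h.exists_smul_eq w
    refine ⟨v, ?_⟩
    rw [pow_succ, mul_smul, hv, ← h.quot_apply hw, ← map_nsmul, hz, add_comm, pow_add, pow_one,
      Module.End.mul_apply]

theorem eval_pow_X_zero (h : IsShort p m L) {n : ℕ} (hn : ∀ y : M, p ^ n • y = 0) :
    h.eval (.X 0 ^ (m * n)) = 0 := by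
  refine LinearMap.ext fun y => ?_
  obtain ⟨z, hz⟩ := h.exists_smul_eq_pow n y
  rw [map_pow, eval_X_zero, ← hz, hn, LinearMap.zero_apply]

theorem eval_pow_X_one (h : IsShort p m L) {n : ℕ} (hn : ∀ y : M, p ^ n • y = 0) :
    h.eval (.X 1 ^ n) = 0 := by
  refine LinearMap.ext fun y => ?_
  obtain ⟨z, hz⟩ := h.exists_smul_eq_quot_pow n y
  rw [map_pow, eval_X_one, ← hz, hn, LinearMap.zero_apply]

end IsShort

/-! ### Substitutions which are the identity to first order -/

/-- The ideal `(X, D)` of the ring of polynomials in `X` and `D`. -/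
noncomputable def augIdeal : Ideal (MvPolynomial (Fin 2) ℤ) := Ideal.span {.X 0, .X 1}

theorem X_mem_augIdeal (i : Fin 2) : (.X i : MvPolynomial (Fin 2) ℤ) ∈ augIdeal :=
  Ideal.subset_span (by fin_cases i <;> simp)

theorem exists_augIdeal_pow_le (a b : ℕ) :
    ∃ N, augIdeal ^ N ≤ Ideal.span {.X 0 ^ a, .X 1 ^ b} := by
  refine Ideal.exists_pow_le_of_le_radical_of_fg ?_ ⟨{.X 0, .X 1}, by simp [augIdeal]⟩
  rw [augIdeal, Ideal.span_le]
  rintro x (rfl | rfl)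
  · exact ⟨a, Ideal.subset_span (by simp)⟩
  · exact ⟨b, Ideal.subset_span (by simp)⟩

/-- The substitution `X ↦ X U`, `D ↦ D U ^ (2 * m)`, which preserves the relation
`p D = X ^ (2 * m)`. -/
noncomputable def substHom (m : ℕ) (U : MvPolynomial (Fin 2) ℤ) :
    MvPolynomial (Fin 2) ℤ →ₐ[ℤ] MvPolynomial (Fin 2) ℤ :=
  MvPolynomial.aeval ![.X 0 * U, .X 1 * U ^ (2 * m)]

section Substitution

variable {m : ℕ} {U : MvPolynomial (Fin 2) ℤ}

theorem substHom_X_zero : substHom m U (.X 0) = .X 0 * U := by simp [substHom]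

theorem substHom_X_one : substHom m U (.X 1) = .X 1 * U ^ (2 * m) := by simp [substHom]

theorem pow_sub_one_mem_augIdeal (hU : U - 1 ∈ augIdeal) (i : ℕ) : U ^ i - 1 ∈ augIdeal :=
  Ideal.mem_of_dvd _ (by simpa using sub_dvd_pow_sub_pow U 1 i) hU

theorem sub_substHom_X_mem (hU : U - 1 ∈ augIdeal) (i : Fin 2) :
    .X i - substHom m U (.X i) ∈ augIdeal ^ 2 := by
  have key : ∀ V, V - 1 ∈ augIdeal →
      (.X i - .X i * V : MvPolynomial (Fin 2) ℤ) ∈ augIdeal ^ 2 := fun V hV => by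
    have : (.X i - .X i * V : MvPolynomial (Fin 2) ℤ) = -(.X i * (V - 1)) := by ring
    rw [this, pow_two]
    exact neg_mem (Ideal.mul_mem_mul (X_mem_augIdeal i) hV)
  fin_cases i
  · exact substHom_X_zero (m := m) (U := U) ▸ key U hU
  · exact substHom_X_one (m := m) (U := U) ▸ key _ (pow_sub_one_mem_augIdeal hU _)

theorem sub_substHom_mem (hU : U - 1 ∈ augIdeal) (F : MvPolynomial (Fin 2) ℤ) :
    F - substHom m U F ∈ augIdeal := by
  induction F using MvPolynomial.induction_on with
  | C c =>
    rw [← MvPolynomial.algebraMap_eq, AlgHom.commutes, sub_self]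
    exact zero_mem _
  | add F G hF hG =>
    rw [map_add, add_sub_add_comm]
    exact add_mem hF hG
  | mul_X F i hF =>
    have : F * .X i - substHom m U (F * .X i) =
        .X i * (F - substHom m U F) + substHom m U F * (.X i - substHom m U (.X i)) := by
      rw [map_mul]; ring
    rw [this]
    exact add_mem (Ideal.mul_mem_left _ _ hF)
      (Ideal.mul_mem_left _ _ (Ideal.pow_le_self two_ne_zero (sub_substHom_X_mem hU i)))

theorem substHom_mem_pow (hU : U - 1 ∈ augIdeal) {N : ℕ} {F : MvPolynomial (Fin 2) ℤ}
    (hF : F ∈ augIdeal ^ N) : substHom m U F ∈ augIdeal ^ N := by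
  have h : augIdeal.map (substHom m U) ≤ augIdeal := by
    rw [Ideal.map_le_iff_le_comap]
    intro G hG
    have := sub_mem hG (sub_substHom_mem (m := m) hU G)
    rwa [sub_sub_cancel] at this
  exact (Ideal.map_pow (substHom m U) augIdeal N ▸ Ideal.pow_right_mono h N)
    (Ideal.mem_map_of_mem _ hF)

/-- The difference between a polynomial and its image under the substitution vanishes at the origin
to a higher order than the polynomial. -/
theorem sub_substHom_mem_pow (hU : U - 1 ∈ augIdeal) {N : ℕ} {F : MvPolynomial (Fin 2) ℤ}
    (hF : F ∈ augIdeal ^ N) : F - substHom m U F ∈ augIdeal ^ (N + 1) := by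
  have mul_mem : ∀ (N : ℕ) (G H : MvPolynomial (Fin 2) ℤ),
      H ∈ augIdeal → G - substHom m U G ∈ augIdeal ^ N → G ∈ augIdeal ^ (N - 1) →
      H - substHom m U H ∈ augIdeal ^ 2 →
      G * H - substHom m U (G * H) ∈ augIdeal ^ (N + 1) := by
    intro N G H hH hG hG' hH'
    have : G * H - substHom m U (G * H) =
        (G - substHom m U G) * H + substHom m U G * (H - substHom m U H) := by
      rw [map_mul]; ring
    rw [this]
    refine add_mem (pow_succ augIdeal N ▸ Ideal.mul_mem_mul hG hH) ?_
    refine Ideal.pow_le_pow_right (by omega : N + 1 ≤ N - 1 + 2) ?_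
    exact pow_add augIdeal (N - 1) 2 ▸ Ideal.mul_mem_mul (substHom_mem_pow hU hG') hH'
  have one : ∀ H ∈ augIdeal, H - substHom m U H ∈ augIdeal ^ 2 := by
    intro H hH
    rw [augIdeal] at hH
    obtain ⟨a, b, rfl⟩ := Ideal.mem_span_pair.mp hH
    rw [map_add, add_sub_add_comm]
    refine add_mem ?_ ?_ <;>
    exact mul_mem 1 _ _ (X_mem_augIdeal _) (by rw [pow_one]; exact sub_substHom_mem hU _) (by simp)
      (sub_substHom_X_mem hU _)
  induction N generalizing F with
  | zero => simpa using sub_substHom_mem hU F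
  | succ N ih =>
    rw [pow_succ] at hF
    refine Submodule.mul_induction_on hF (fun G hG H hH => ?_) fun G H hG hH => ?_
    · exact mul_mem (N + 1) G H hH (ih hG) hG (one H hH)
    · rw [map_add, add_sub_add_comm]
      exact add_mem hG hH

/-- A substitution which is the identity to first order is onto up to any order. -/
theorem exists_substHom_sub_mem (hU : U - 1 ∈ augIdeal) (F : MvPolynomial (Fin 2) ℤ) (N : ℕ) :
    ∃ G, F - substHom m U G ∈ augIdeal ^ N := by
  induction N with
  | zero => exact ⟨0, by simp⟩
  | succ N ih =>
    obtain ⟨G, hG⟩ := ih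
    refine ⟨G + (F - substHom m U G), ?_⟩
    rw [map_add, ← sub_sub]
    exact sub_substHom_mem_pow hU hG

theorem exists_mul_sub_one_mem (hU : U - 1 ∈ augIdeal) (N : ℕ) :
    ∃ V, V * U - 1 ∈ augIdeal ^ N := by
  refine ⟨∑ i ∈ Finset.range N, (1 - U) ^ i, ?_⟩
  have h : (∑ i ∈ Finset.range N, (1 - U) ^ i) * U - 1 = -(1 - U) ^ N := by
    have := geom_sum_mul (1 - U) N
    linear_combination -this
  rw [h]
  exact neg_mem (Ideal.pow_mem_pow (by rw [← neg_sub]; exact neg_mem hU) N)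

end Substitution

namespace IsShort

variable {M : Type*} [AddCommGroup M] {p m : ℕ} {L L₁ L₂ : Module.End ℤ M}

theorem eval_eq_zero_of_mem (h : IsShort p m L) {n N : ℕ} (hn : ∀ y : M, p ^ n • y = 0)
    (hN : augIdeal ^ N ≤ Ideal.span {.X 0 ^ (m * n), .X 1 ^ n}) {F : MvPolynomial (Fin 2) ℤ}
    (hF : F ∈ augIdeal ^ N) : h.eval F = 0 := by
  obtain ⟨a, b, rfl⟩ := Ideal.mem_span_pair.mp (hN hF)
  rw [map_add, map_mul, map_mul, h.eval_pow_X_zero hn, h.eval_pow_X_one hn, mul_zero, mul_zero,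
    add_zero]

theorem eval_X_mul_pow_apply (h : IsShort p m L) (U : MvPolynomial (Fin 2) ℤ) (i : ℕ) (y : M) :
    (h.eval (.X 0 * U) ^ i) y = (L ^ i) (h.eval (U ^ i) y) := by
  rw [← map_pow, mul_pow, map_mul, map_pow, eval_X_zero, Module.End.mul_apply]

/-- The multiples of `L` by polynomials in `L` and `L ^ (2 * m) / p` inherit the divisibility of
the `m`-th power. -/
theorem eval_X_mul (h : IsShort p m L) (U : MvPolynomial (Fin 2) ℤ) :
    IsShort p m (h.eval (.X 0 * U)) where
  exists_smul_eq y := by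
    rw [eval_X_mul_pow_apply]
    exact h.exists_smul_eq _
  pow_apply_eq_zero y hy := by
    rw [eval_X_mul_pow_apply]
    exact h.pow_apply_eq_zero _ (by rw [← map_nsmul, hy, map_zero])

theorem quot_eval_X_mul (h : IsShort p m L) (U : MvPolynomial (Fin 2) ℤ) :
    (h.eval_X_mul U).quot = h.eval (.X 1 * U ^ (2 * m)) := by
  refine LinearMap.ext fun y => ?_
  obtain ⟨z, hz⟩ := h.exists_smul_eq (h.eval (U ^ m) y)
  have hz' := hz
  rw [← eval_X_mul_pow_apply] at hz'
  have hX : (.X 1 * U ^ (2 * m) : MvPolynomial (Fin 2) ℤ) = U ^ m * (.X 1 * U ^ m) := by ring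
  rw [(h.eval_X_mul U).quot_apply hz', eval_X_mul_pow_apply, hX, map_mul, map_mul,
    Module.End.mul_apply, Module.End.mul_apply, eval_X_one, h.quot_apply hz]
  have := h.eval_mul_comm (.X 0 ^ m) (U ^ m) z
  rwa [map_pow, eval_X_zero] at this

theorem eval_substHom (h : IsShort p m L) (U F : MvPolynomial (Fin 2) ℤ) :
    h.eval (substHom m U F) = (h.eval_X_mul U).eval F := by
  have : h.eval.comp (substHom m U).toRingHom = (h.eval_X_mul U).eval := by
    refine MvPolynomial.ringHom_ext (fun c => ?_) fun i => ?_
    · rw [← MvPolynomial.algebraMap_eq, eq_intCast, map_intCast, map_intCast]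
    · fin_cases i
      · simp [substHom_X_zero]
      · have := h.quot_eval_X_mul U
        simp only [AlgHom.toRingHom_eq_coe, Fin.mk_one, RingHom.coe_comp, RingHom.coe_coe,
          Function.comp_apply, substHom_X_one, eval_X_one]
        exact this.symm
  exact congrArg (fun φ => φ F) this

theorem eval_apply_eval_of_mul_sub_one_mem (h : IsShort p m L) {n N : ℕ}
    (hn : ∀ y : M, p ^ n • y = 0)
    (hN : augIdeal ^ N ≤ Ideal.span {.X 0 ^ (m * n), .X 1 ^ n}) {U V : MvPolynomial (Fin 2) ℤ}
    (hV : V * U - 1 ∈ augIdeal ^ N) (y : M) : h.eval V (h.eval U y) = y := by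
  have := h.eval_eq_zero_of_mem hn hN hV
  rw [map_sub, map_one, sub_eq_zero, map_mul] at this
  rw [← Module.End.mul_apply, this, Module.End.one_apply]

theorem eval_injective (h : IsShort p m L) {n : ℕ} (hn : ∀ y : M, p ^ n • y = 0)
    {U : MvPolynomial (Fin 2) ℤ} (hU : U - 1 ∈ augIdeal) : Function.Injective (h.eval U) := by
  obtain ⟨N, hN⟩ := exists_augIdeal_pow_le (m * n) n
  obtain ⟨V, hV⟩ := exists_mul_sub_one_mem hU N
  exact Function.LeftInverse.injective
    (h.eval_apply_eval_of_mul_sub_one_mem hn hN hV)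

/-- The endomorphism `L` can be recovered from `E = L U(L)`, as a polynomial in `E` and
`E ^ (2 * m) / p`. -/
theorem eq_of_eval_X_mul_eq (h₁ : IsShort p m L₁) (h₂ : IsShort p m L₂) {n : ℕ}
    (hn : ∀ y : M, p ^ n • y = 0) {U : MvPolynomial (Fin 2) ℤ} (hU : U - 1 ∈ augIdeal)
    (h : h₁.eval (.X 0 * U) = h₂.eval (.X 0 * U)) : L₁ = L₂ := by
  obtain ⟨N, hN⟩ := exists_augIdeal_pow_le (m * n) n
  obtain ⟨G, hG⟩ := exists_substHom_sub_mem (m := m) hU (.X 0) N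
  have key : ∀ {L : Module.End ℤ M} (hL : IsShort p m L),
      L = (hL.eval_X_mul U).eval G := fun hL => by
    have := hL.eval_eq_zero_of_mem hn hN hG
    rw [map_sub, sub_eq_zero, eval_X_zero] at this
    rw [← eval_substHom, ← this]
  rw [key h₁, key h₂, eval_congr _ _ h]

/-- If `L₁ U(L₁) = L₂ U(L₂)`, then `L₁ = L₂`, so `U(L₁)` and `U(L₂)` are the same injective map. -/
theorem eq_of_eval_apply_eq (h₁ : IsShort p m L₁) (h₂ : IsShort p m L₂) {n : ℕ}
    (hn : ∀ y : M, p ^ n • y = 0) {U : MvPolynomial (Fin 2) ℤ} (hU : U - 1 ∈ augIdeal)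
    (h : h₁.eval (.X 0 * U) = h₂.eval (.X 0 * U)) {y z : M} (hyz : h₁.eval U y = h₂.eval U z) :
    y = z := by
  rw [← eval_congr h₁ h₂ (h₁.eq_of_eval_X_mul_eq h₂ hn hU h)] at hyz
  exact h₁.eval_injective hn hU hyz

end IsShort

/-! ### The polynomial of `p ^ k`-th powers -/

/-- Modulo `p D = X ^ (2 * m)`, the sum `1 + (1 + Y) + ⋯ + (1 + Y) ^ (p - 1)` is `p` times a
polynomial with constant term `1`, if `X` divides `Y`: in `((1 + Y) ^ p - 1) / Y` all coefficients
but the last are divisible by `p`, and the last one belongs to `Y ^ (p - 1)`. -/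
theorem exists_smul_sub_geomSum_mem {p m : ℕ} (hp : p.Prime) (hm : 2 * m ≤ p - 1)
    (W : MvPolynomial (Fin 2) ℤ) :
    ∃ V : MvPolynomial (Fin 2) ℤ, V - 1 ∈ augIdeal ∧
      p * V - ∑ i ∈ Finset.range p, (1 + .X 0 * W) ^ i ∈
        Ideal.span {(p : MvPolynomial (Fin 2) ℤ) * .X 1 - .X 0 ^ (2 * m)} := by
  obtain ⟨q, rfl⟩ : ∃ q, p = q + 2 := ⟨p - 2, by have := hp.two_le; omega⟩
  have hchoose : ∀ j ∈ Finset.range (q + 1),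
      ((q + 2).choose (j + 1) : MvPolynomial (Fin 2) ℤ) =
        ((q + 2 : ℕ) : MvPolynomial (Fin 2) ℤ) * ((q + 2).choose (j + 1) / (q + 2) : ℕ) := by
    intro j hj
    rw [← Nat.cast_mul, Nat.mul_div_cancel' (hp.dvd_choose_self (Nat.succ_ne_zero j)
      (by have := Finset.mem_range.mp hj; omega))]
  have hsum : ∑ i ∈ Finset.range (q + 2), (1 + .X 0 * W : MvPolynomial (Fin 2) ℤ) ^ i =
      ∑ j ∈ Finset.range (q + 2), ((q + 2).choose (j + 1) : MvPolynomial (Fin 2) ℤ) *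
        (.X 0 * W) ^ j := by
    have := congrArg (Polynomial.eval (.X 0 * W : MvPolynomial (Fin 2) ℤ))
      (Polynomial.geom_sum_X_comp_X_add_one_eq_sum (R := MvPolynomial (Fin 2) ℤ) (q + 2))
    simpa [Polynomial.eval_finsetSum, add_comm] using this
  refine ⟨∑ j ∈ Finset.range (q + 1), ((q + 2).choose (j + 1) / (q + 2) : ℕ) * (.X 0 * W) ^ j +
    .X 0 ^ (q + 1 - 2 * m) * .X 1 * W ^ (q + 1), ?_, ?_⟩
  · rw [Finset.sum_range_succ']
    simp only [zero_add, Nat.choose_one_right, pow_zero, mul_one]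
    rw [Nat.div_self (by omega), Nat.cast_one, add_right_comm, add_sub_cancel_right]
    refine add_mem (Ideal.sum_mem _ fun j _ => ?_) ?_
    · rw [pow_succ]
      exact Ideal.mul_mem_left _ _ (Ideal.mul_mem_left _ _
        (Ideal.mul_mem_right _ _ (X_mem_augIdeal 0)))
    · exact Ideal.mul_mem_right _ _ (Ideal.mul_mem_left _ _ (X_mem_augIdeal 1))
  · have hterm : ∀ j ∈ Finset.range (q + 1),
        ((q + 2 : ℕ) : MvPolynomial (Fin 2) ℤ) *
          (((q + 2).choose (j + 1) / (q + 2) : ℕ) * (.X 0 * W) ^ j) =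
        ((q + 2).choose (j + 1) : MvPolynomial (Fin 2) ℤ) * (.X 0 * W) ^ j := fun j hj => by
      rw [hchoose j hj, mul_assoc]
    rw [hsum, Finset.sum_range_succ _ (q + 1), Nat.choose_self, Nat.cast_one, one_mul, mul_add,
      Finset.mul_sum, Finset.sum_congr rfl hterm, add_sub_add_left_eq_sub, Ideal.mem_span_singleton']
    refine ⟨.X 0 ^ (q + 1 - 2 * m) * W ^ (q + 1), ?_⟩
    have : (.X 0 : MvPolynomial (Fin 2) ℤ) ^ (q + 1) = .X 0 ^ (q + 1 - 2 * m) * .X 0 ^ (2 * m) := by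
      rw [← pow_add]; congr 1; omega
    rw [mul_pow, this]
    ring

/-- The polynomial `U` is congruent to `((1 + X) ^ (p ^ k) - 1) / (p ^ k * X)` modulo the relation
`p D = X ^ (2 * m)`. -/
def IsPowPoly (p m k : ℕ) (U : MvPolynomial (Fin 2) ℤ) : Prop :=
  (p : MvPolynomial (Fin 2) ℤ) ^ k * U - ∑ i ∈ Finset.range (p ^ k), (1 + .X 0) ^ i ∈
    Ideal.span {(p : MvPolynomial (Fin 2) ℤ) * .X 1 - .X 0 ^ (2 * m)}

theorem geomSum_mul_geomSum {R : Type*} [CommRing R] (x : R) (a b : ℕ) :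
    (∑ i ∈ Finset.range a, x ^ i) * ∑ i ∈ Finset.range b, (x ^ a) ^ i =
      ∑ i ∈ Finset.range (a * b), x ^ i := by
  induction b with
  | zero => simp
  | succ b ih =>
    rw [Finset.sum_range_succ, mul_add, ih, mul_add_one a b, Finset.sum_range_add, Finset.sum_mul]
    congr 1
    refine Finset.sum_congr rfl fun i _ => ?_
    rw [← pow_mul, ← pow_add, add_comm]

theorem exists_isPowPoly {p m : ℕ} (hp : p.Prime) (hm : 2 * m ≤ p - 1) (k : ℕ) :
    ∃ U, U - 1 ∈ augIdeal ∧ IsPowPoly p m k U := by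
  induction k with
  | zero => exact ⟨1, by simp, by simp [IsPowPoly]⟩
  | succ k ih =>
    obtain ⟨U, hU, hUk⟩ := ih
    obtain ⟨V, hV, hVk⟩ := exists_smul_sub_geomSum_mem hp hm (p ^ k * U)
    refine ⟨U * V, ?_, ?_⟩
    · have : U * V - 1 = (U - 1) * V + (V - 1) := by ring
      rw [this]
      exact add_mem (Ideal.mul_mem_right _ _ hU) hV
    · rw [IsPowPoly, ← Ideal.Quotient.mk_eq_mk_iff_sub_mem] at hUk ⊢
      rw [← Ideal.Quotient.mk_eq_mk_iff_sub_mem] at hVk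
      have hpow := geom_sum_mul (1 + .X 0 : MvPolynomial (Fin 2) ℤ) (p ^ k)
      rw [add_sub_cancel_left, eq_sub_iff_add_eq] at hpow
      have hmul : (p : MvPolynomial (Fin 2) ℤ) ^ (k + 1) * (U * V) = p ^ k * U * (p * V) := by ring
      rw [hmul, pow_succ p k, ← geomSum_mul_geomSum, map_mul _ _ (p * V : MvPolynomial (Fin 2) ℤ),
        map_mul _ (∑ i ∈ Finset.range (p ^ k), _), hUk, hVk, ← hpow]
      congr 1
      have hXU : Ideal.Quotient.mk (Ideal.span {(p : MvPolynomial (Fin 2) ℤ) * .X 1 -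
          .X 0 ^ (2 * m)}) (.X 0 * (p ^ k * U)) =
          Ideal.Quotient.mk _ ((∑ i ∈ Finset.range (p ^ k), (1 + .X 0) ^ i) * .X 0) := by
        rw [RingHom.map_mul, hUk, RingHom.map_mul]
        exact mul_comm _ _
      rw [map_sum, map_sum]
      refine Finset.sum_congr rfl fun i _ => ?_
      rw [map_pow, map_pow, map_add, map_add, hXU, add_comm]

/-! ### Powers of elements in a brace -/

namespace LeftBrace

variable {A : Type*} [AddCommGroup A] (B : LeftBrace A)

/-- The additive map `b ↦ a * b`. -/
def starHom (a : A) : Module.End ℤ A :=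
  AddMonoidHom.toIntLinearMap <| AddMonoidHom.mk' (B.star a) fun b c => by
    simp only [star, circ_add]
    abel

theorem starHom_apply (a b : A) : B.starHom a b = B.star a b := rfl

theorem circ_eq_add_apply (a b : A) : B.circ a b = a + (1 + B.starHom a) b := by
  rw [circ_eq, LinearMap.add_apply, Module.End.one_apply, starHom_apply, add_assoc]

theorem one_add_starHom_circ (a b : A) :
    1 + B.starHom (B.circ a b) = (1 + B.starHom a) * (1 + B.starHom b) := by
  refine LinearMap.ext fun c => ?_
  have h := B.circ_assoc a b c
  rw [B.circ_eq_add_apply _ c, B.circ_eq_add_apply a (B.circ b c), B.circ_eq_add_apply b c,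
    map_add, ← add_assoc, ← B.circ_eq_add_apply a b] at h
  exact add_left_cancel h

theorem starHom_zero : B.starHom 0 = 0 :=
  LinearMap.ext fun b => by
    rw [starHom_apply, star, zero_circ, sub_zero, sub_self, LinearMap.zero_apply]

/-- The power `a ∘ a ∘ ⋯ ∘ a` with `j` factors. -/
def cpow (a : A) (j : ℕ) : A := (B.circ a)^[j] 0

theorem cpow_succ (a : A) (j : ℕ) : B.cpow a (j + 1) = B.circ a (B.cpow a j) :=
  Function.iterate_succ_apply' _ _ _

theorem one_add_starHom_cpow (a : A) (j : ℕ) :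
    1 + B.starHom (B.cpow a j) = (1 + B.starHom a) ^ j := by
  induction j with
  | zero => rw [cpow, Function.iterate_zero_apply, starHom_zero, add_zero, pow_zero]
  | succ j ih => rw [cpow_succ, one_add_starHom_circ, ih, pow_succ']

theorem cpow_eq_sum (a : A) (j : ℕ) :
    B.cpow a j = (∑ i ∈ Finset.range j, (1 + B.starHom a) ^ i) a := by
  induction j with
  | zero => simp [cpow]
  | succ j ih =>
    rw [cpow_succ, circ_eq_add_apply, ih, Finset.sum_range_succ', ← Module.End.mul_apply,
      Finset.mul_sum, pow_zero, LinearMap.add_apply, Module.End.one_apply, add_comm]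
    simp only [pow_succ']

theorem cpow_conj (a c : A) (j : ℕ) :
    B.cpow (B.circ (B.circ (B.cinv c) a) c) j = B.circ (B.circ (B.cinv c) (B.cpow a j)) c := by
  induction j with
  | zero => simp [cpow, circ_zero, cinv_circ]
  | succ j ih =>
    rw [cpow_succ, cpow_succ, ih]
    simp only [circ_assoc]
    rw [← B.circ_assoc c (B.cinv c), circ_cinv, zero_circ]

variable {B}

/-- An additive subgroup is an ideal if it is invariant under `b ↦ a * b` and normal in the
group `(A, ∘)`. -/
theorem isIdeal_of_conj_mem {I : AddSubgroup A} (hstar : ∀ i ∈ I, ∀ a, B.star a i ∈ I)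
    (hconj : ∀ i ∈ I, ∀ a, B.circ (B.circ (B.cinv a) i) a ∈ I) : B.IsIdeal I := by
  refine fun i hi a => ⟨?_, hstar i hi a⟩
  have h : B.circ i a = B.circ a (B.circ (B.circ (B.cinv a) i) a) := by
    rw [circ_assoc, ← B.circ_assoc a, circ_cinv, zero_circ]
  have hc := hconj i hi a
  have : B.star i a = B.circ (B.circ (B.cinv a) i) a +
      B.star a (B.circ (B.circ (B.cinv a) i) a) - i := by
    rw [star, h, circ_eq]
    abel
  rw [this]
  exact I.sub_mem (I.add_mem hc (hstar _ hc _)) hi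

variable (B)

/-- The `m`-fold products `a * (a * (⋯ * b))` belong to `pA`, and to `ann(p ^ i)` if `b` belongs to
`ann(p ^ (i + 1))`. -/
structure HasDivisiblePowers (p m : ℕ) : Prop where
  exists_smul_eq : ∀ a b, ∃ z, p • z = (B.starHom a ^ m) b
  smul_eq_zero : ∀ i a b, p ^ (i + 1) • b = 0 → p ^ i • (B.starHom a ^ m) b = 0

variable {B} {p m n k : ℕ} {U : MvPolynomial (Fin 2) ℤ}

/-- The exponent in the hypothesis on short products can be taken to depend only on `p`. -/
theorem HasShortProducts.hasDivisiblePowers (h : B.HasShortProducts p) :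
    B.HasDivisiblePowers p ((p - 2) / 4) := by
  obtain ⟨m, hm, h₁, h₂⟩ := h
  have hle : m ≤ (p - 2) / 4 := by
    have h4 : (4 * m + 1 : ℚ) < p := by linarith
    have h4' : 4 * m + 1 < p := by exact_mod_cast h4
    omega
  obtain ⟨r, hr⟩ := Nat.exists_eq_add_of_le' hle
  have hiter : ∀ a b : A, (B.star a)^[m] b = (B.starHom a ^ m) b := fun a b => by
    rw [Module.End.pow_apply]; rfl
  rw [hr]
  constructor
  · intro a b
    obtain ⟨z, hz⟩ := h₁ a b
    refine ⟨(B.starHom a ^ r) z, ?_⟩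
    rw [← map_nsmul, hz, hiter, pow_add, Module.End.mul_apply]
  · intro i a b hb
    have hz : p ^ i • (B.star a)^[m] b = 0 := h₂ (i + 1) (Nat.le_add_left 1 i) a b hb
    rw [pow_add, Module.End.mul_apply, ← map_nsmul, ← hiter, hz, map_zero]

/-- The projection of `A` onto the factor group by `I`, as a linear map. -/
abbrev mkHom (I : AddSubgroup A) : A →ₗ[ℤ] A ⧸ I := (QuotientAddGroup.mk' I).toIntLinearMap

theorem mk_annihilated_eq_iff {q : ℕ} {x y : A} :
    (x : A ⧸ annihilated A q) = y ↔ q • x = q • y := by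
  rw [eq_comm, QuotientAddGroup.eq, neg_add_eq_sub, ← sub_eq_zero (a := q • x), ← smul_sub]
  rfl

namespace HasDivisiblePowers

theorem isShort (hB : B.HasDivisiblePowers p m) (a : A) : IsShort p m (B.starHom a) where
  exists_smul_eq := hB.exists_smul_eq a
  pow_apply_eq_zero y hy := by simpa using hB.smul_eq_zero 0 a y (by simpa using hy)

theorem isShort_factor (hB : B.HasDivisiblePowers p m) (hI : B.IsIdeal (annihilated A (p ^ k)))
    (x : A ⧸ annihilated A (p ^ k)) :
    IsShort p m ((B.factor (annihilated A (p ^ k)) hI).starHom x) := by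
  obtain ⟨a, rfl⟩ := QuotientAddGroup.mk_surjective x
  have hpow := IsShort.map_pow_apply (f := mkHom (annihilated A (p ^ k))) (L := B.starHom a)
    (L' := (B.factor _ hI).starHom a) (fun _ => rfl) m
  constructor
  · intro y
    obtain ⟨b, rfl⟩ := QuotientAddGroup.mk_surjective y
    obtain ⟨z, hz⟩ := hB.exists_smul_eq a b
    exact ⟨mkHom _ z, by rw [← map_nsmul, hz]; exact hpow b⟩
  · intro y hy
    obtain ⟨b, rfl⟩ := QuotientAddGroup.mk_surjective y
    have hb : p ^ (k + 1) • b = 0 := by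
      have : ((p • b : A) : A ⧸ annihilated A (p ^ k)) = (0 : A) := hy
      rwa [mk_annihilated_eq_iff, smul_zero, ← mul_smul, ← pow_succ] at this
    refine (hpow b).symm.trans ?_
    exact mk_annihilated_eq_iff.mpr ((hB.smul_eq_zero k a b hb).trans (smul_zero _).symm)

theorem mk_eval (hB : B.HasDivisiblePowers p m) (hI : B.IsIdeal (annihilated A (p ^ k)))
    (F : MvPolynomial (Fin 2) ℤ) (a b : A) :
    (((hB.isShort a).eval F b : A) : A ⧸ annihilated A (p ^ k)) =
      (hB.isShort_factor hI (a : A ⧸ annihilated A (p ^ k))).eval F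
        (b : A ⧸ annihilated A (p ^ k)) :=
  (hB.isShort a).map_eval (hB.isShort_factor hI (a : A ⧸ annihilated A (p ^ k)))
    (f := mkHom (annihilated A (p ^ k))) (fun _ => rfl) F b

theorem smul_eval_eq_sum (hB : B.HasDivisiblePowers p m) (hU : IsPowPoly p m k U) (a b : A) :
    p ^ k • (hB.isShort a).eval U b =
      (∑ i ∈ Finset.range (p ^ k), (1 + B.starHom a) ^ i) b := by
  have h := congrArg (fun f => f b) ((hB.isShort a).eval_eq_of_sub_mem hU)
  simp only [map_mul, map_pow, map_natCast, map_sum, map_add, map_one, IsShort.eval_X_zero] at h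
  rw [← h, Module.End.mul_apply, ← Nat.cast_pow, Module.End.natCast_apply]

/-- The `p ^ k`-th power of `a` is `p ^ k` times `U a`. -/
theorem cpow_eq_smul_eval (hB : B.HasDivisiblePowers p m) (hU : IsPowPoly p m k U) (a : A) :
    B.cpow a (p ^ k) = p ^ k • (hB.isShort a).eval U a := by
  rw [cpow_eq_sum, hB.smul_eval_eq_sum hU]

theorem star_cpow (hB : B.HasDivisiblePowers p m) (hU : IsPowPoly p m k U) (a b : A) :
    B.star (B.cpow a (p ^ k)) b = p ^ k • (hB.isShort a).eval (.X 0 * U) b := by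
  have h : B.starHom (B.cpow a (p ^ k)) =
      (∑ i ∈ Finset.range (p ^ k), (1 + B.starHom a) ^ i) * B.starHom a := by
    have := geom_sum_mul (1 + B.starHom a) (p ^ k)
    rwa [← one_add_starHom_cpow, add_sub_cancel_left, add_sub_cancel_left, eq_comm] at this
  rw [← starHom_apply, h, Module.End.mul_apply, ← hB.smul_eval_eq_sum hU, mul_comm, map_mul,
    Module.End.mul_apply, IsShort.eval_X_zero]

theorem star_smul_eval (hB : B.HasDivisiblePowers p m) (hU : IsPowPoly p m k U) (a b : A) :
    B.star (p ^ k • (hB.isShort a).eval U a) b = p ^ k • (hB.isShort a).eval (.X 0 * U) b := by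
  rw [← hB.cpow_eq_smul_eval hU, hB.star_cpow hU]

theorem cpow_eq_zero_iff (hB : B.HasDivisiblePowers p m) (hn : ∀ y : A, p ^ n • y = 0)
    (hU : U - 1 ∈ augIdeal) (hUk : IsPowPoly p m k U) (a : A) :
    B.cpow a (p ^ k) = 0 ↔ p ^ k • a = 0 := by
  rw [hB.cpow_eq_smul_eval hUk, ← map_nsmul]
  exact map_eq_zero_iff _ ((hB.isShort a).eval_injective hn hU)

/-- The subgroup `ann(p ^ k)` consists of the elements whose `p ^ k`-th power in `(A, ∘)` is
trivial, so it is normal in `(A, ∘)`. -/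
theorem isIdeal_annihilated (hB : B.HasDivisiblePowers p m) (hn : ∀ y : A, p ^ n • y = 0)
    (hU : U - 1 ∈ augIdeal) (hUk : IsPowPoly p m k U) :
    B.IsIdeal (annihilated A (p ^ k)) := by
  refine isIdeal_of_conj_mem (fun i hi a => ?_) fun i hi a => ?_
  · have hi' : p ^ k • i = 0 := hi
    change p ^ k • B.starHom a i = 0
    rw [← map_nsmul, hi', map_zero]
  · refine (hB.cpow_eq_zero_iff hn hU hUk _).mp ?_
    rw [cpow_conj, (hB.cpow_eq_zero_iff hn hU hUk i).mpr hi, circ_zero, cinv_circ]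

/-- The `p ^ k`-th power of `a` determines `p ^ k a`. -/
theorem smul_eq_smul_of_smul_eval_eq (hB : B.HasDivisiblePowers p m)
    (hn : ∀ y : A, p ^ n • y = 0) (hU : U - 1 ∈ augIdeal) (hUk : IsPowPoly p m k U) {a b : A}
    (hab : p ^ k • (hB.isShort a).eval U a = p ^ k • (hB.isShort b).eval U b) :
    p ^ k • a = p ^ k • b := by
  have hI := hB.isIdeal_annihilated hn hU hUk
  rw [← mk_annihilated_eq_iff] at hab ⊢
  rw [hB.mk_eval hI, hB.mk_eval hI] at hab
  refine IsShort.eq_of_eval_apply_eq _ _ (n := n) ?_ hU ?_ hab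
  · intro y
    obtain ⟨y, rfl⟩ := QuotientAddGroup.mk_surjective y
    exact congrArg _ (hn y)
  · refine LinearMap.ext fun y => ?_
    obtain ⟨y, rfl⟩ := QuotientAddGroup.mk_surjective y
    rw [← hB.mk_eval hI, ← hB.mk_eval hI, mk_annihilated_eq_iff] at *
    rw [← hB.star_smul_eval hUk, ← hB.star_smul_eval hUk, hab]

/-- Every element of `p ^ k A` is a `p ^ k`-th power, because distinct elements `p ^ k a` have
distinct powers and `A` is finite. -/
theorem exists_smul_eval_eq [Finite A] (hB : B.HasDivisiblePowers p m)
    (hn : ∀ y : A, p ^ n • y = 0) (hU : U - 1 ∈ augIdeal) (hUk : IsPowPoly p m k U) (x : A) :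
    ∃ a, p ^ k • (hB.isShort a).eval U a = p ^ k • x := by
  choose f hf using fun y : multiples A (p ^ k) => y.2
  let g : multiples A (p ^ k) → multiples A (p ^ k) := fun y =>
    multiple (p ^ k) ((hB.isShort (f y)).eval U (f y))
  have hg : Function.Injective g := fun y z hyz => Subtype.ext <| by
    rw [← hf, ← hf z]
    exact hB.smul_eq_smul_of_smul_eval_eq hn hU hUk (congrArg Subtype.val hyz)
  obtain ⟨y, hy⟩ := Finite.surjective_of_injective hg (multiple (p ^ k) x)
  exact ⟨f y, congrArg Subtype.val hy⟩

theorem exists_smul_eq_star [Finite A] (hB : B.HasDivisiblePowers p m)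
    (hn : ∀ y : A, p ^ n • y = 0) (hU : U - 1 ∈ augIdeal) (hUk : IsPowPoly p m k U) (x : A) :
    ∃ E : Module.End ℤ A, ∀ y, B.star (p ^ k • x) y = p ^ k • E y := by
  obtain ⟨a, ha⟩ := hB.exists_smul_eval_eq hn hU hUk x
  exact ⟨(hB.isShort a).eval (.X 0 * U), fun y => by rw [← ha, hB.star_smul_eval hUk]⟩

theorem isIdeal_multiples [Finite A] (hB : B.HasDivisiblePowers p m)
    (hn : ∀ y : A, p ^ n • y = 0) (hU : U - 1 ∈ augIdeal) (hUk : IsPowPoly p m k U) :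
    B.IsIdeal (multiples A (p ^ k)) := by
  rintro _ ⟨x, rfl⟩ y
  obtain ⟨E, hE⟩ := hB.exists_smul_eq_star hn hU hUk x
  refine ⟨⟨E y, (hE y).symm⟩, ⟨B.starHom y x, ?_⟩⟩
  rw [← map_nsmul, starHom_apply]

/-- The product `(p ^ k x) * (p ^ k y)` depends only on `p ^ (2 * k) x` and `p ^ (2 * k) y`. -/
theorem star_smul_smul_congr [Finite A] (hB : B.HasDivisiblePowers p m)
    (hn : ∀ y : A, p ^ n • y = 0) (hU : U - 1 ∈ augIdeal) (hUk : IsPowPoly p m k U)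
    {x x' y y' : A} (hx : p ^ (2 * k) • x = p ^ (2 * k) • x')
    (hy : p ^ (2 * k) • y = p ^ (2 * k) • y') :
    B.star (p ^ k • x) (p ^ k • y) = B.star (p ^ k • x') (p ^ k • y') := by
  have hI := hB.isIdeal_annihilated hn hU hUk
  rw [two_mul, pow_add, mul_smul, mul_smul] at hx hy
  obtain ⟨E, hE⟩ := hB.exists_smul_eq_star hn hU hUk x
  -- As the left factor is in `p ^ k A`, only `p ^ (2 * k) y` matters; the left factor itself only
  -- matters modulo `ann(p ^ k)`, since the right factor is a multiple of `p ^ k`.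
  rw [hE, ← map_nsmul, hy, map_nsmul, ← hE, ← starHom_apply, ← starHom_apply, map_nsmul,
    map_nsmul, ← mk_annihilated_eq_iff, starHom_apply, starHom_apply, ← factor_star_mk B _ hI,
    ← factor_star_mk B _ hI, mk_annihilated_eq_iff.mpr hx]

/-- There is an operation `⊙` on `A / ann(p ^ (2 * k))` such that
`p ^ (2 * k) (x ⊙ y) = (p ^ k x) * (p ^ k y)`. -/
theorem exists_odot [Finite A] (hB : B.HasDivisiblePowers p m) (hn : ∀ y : A, p ^ n • y = 0)
    (hU : U - 1 ∈ augIdeal) (hUk : IsPowPoly p m k U) :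
    ∃ op : A ⧸ annihilated A (p ^ (2 * k)) → A ⧸ annihilated A (p ^ (2 * k)) →
        A ⧸ annihilated A (p ^ (2 * k)),
      ∀ x y z : A, p ^ (2 * k) • z = B.star (p ^ k • x) (p ^ k • y) →
        op (x : A ⧸ annihilated A (p ^ (2 * k))) (y : A ⧸ annihilated A (p ^ (2 * k))) =
          (z : A ⧸ annihilated A (p ^ (2 * k))) := by
  have h : ∀ x y : A ⧸ annihilated A (p ^ (2 * k)), ∃ z : A,
      p ^ (2 * k) • z = B.star (p ^ k • x.out) (p ^ k • y.out) := fun x y => by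
    obtain ⟨E, hE⟩ := hB.exists_smul_eq_star hn hU hUk x.out
    exact ⟨E y.out, by rw [hE, map_nsmul, ← mul_smul, ← pow_add, ← two_mul]⟩
  choose op hop using h
  refine ⟨fun x y => op x y, fun x y z hz => mk_annihilated_eq_iff.mpr ?_⟩
  rw [hop, hz]
  exact hB.star_smul_smul_congr hn hU hUk (mk_annihilated_eq_iff.mp (Quotient.out_eq _))
    (mk_annihilated_eq_iff.mp (Quotient.out_eq _))

end HasDivisiblePowers

end LeftBrace

/-! ### Expressible operations -/

namespace BraceFormula

variable {G : Type*} [AddCommGroup G] {p : ℕ}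

/-- The expression `s ⊙ (s ⊙ (⋯ ⊙ t))` with `j` factors `s`. -/
def odotIter (s t : BraceFormula) (j : ℕ) : BraceFormula := (odot s)^[j] t

theorem eval_odotIter {op : G → G → G} {ρ : Pullback G p} {a b x y : G} {s t : BraceFormula}
    (hs : s.eval op ρ a b = some x) (ht : t.eval op ρ a b = some y) (j : ℕ) :
    (odotIter s t j).eval op ρ a b = some ((op x)^[j] y) := by
  induction j with
  | zero => exact ht
  | succ j ih =>
    rw [odotIter, Function.iterate_succ_apply', Function.iterate_succ_apply', eval, hs]
    rw [odotIter] at ih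
    rw [ih]
    rfl

theorem eval_pull {op : G → G → G} {ρ : Pullback G p} {a b x : G} {t : BraceFormula}
    (ht : t.eval op ρ a b = some x) (hx : x ∈ multiples G p) :
    (pull t).eval op ρ a b = some (ρ.toFun ⟨x, hx⟩) := by
  rw [eval, ht, Option.bind_some, dif_pos hx]

end BraceFormula

/-- A family of binary operations on `G`, indexed like the family `op`, is expressible if a single
formula describes each of them through the corresponding operation `op i`, whatever the pullback
function. -/
def IsExpressible {ι G : Type*} [AddCommGroup G] (p : ℕ) (op t : ι → G → G → G) : Prop :=
  ∃ q : BraceFormula, ∀ (i : ι) (ρ : Pullback G p) (a b : G),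
    q.eval (op i) ρ a b = some (t i a b)

namespace IsExpressible

variable {ι G : Type*} [AddCommGroup G] {p : ℕ} {op s t : ι → G → G → G}

theorem fst : IsExpressible p op fun _ a _ => a := ⟨.fst, fun _ _ _ _ => rfl⟩

theorem snd : IsExpressible p op fun _ _ b => b := ⟨.snd, fun _ _ _ _ => rfl⟩

theorem add (hs : IsExpressible p op s) (ht : IsExpressible p op t) :
    IsExpressible p op fun i a b => s i a b + t i a b := by
  obtain ⟨q, hq⟩ := hs
  obtain ⟨r, hr⟩ := ht
  refine ⟨.add q r, fun i ρ a b => ?_⟩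
  rw [BraceFormula.eval, hq, hr]
  rfl

theorem odot (hs : IsExpressible p op s) (ht : IsExpressible p op t) :
    IsExpressible p op fun i a b => op i (s i a b) (t i a b) := by
  obtain ⟨q, hq⟩ := hs
  obtain ⟨r, hr⟩ := ht
  exact ⟨.odotIter q r 1, fun i ρ a b => BraceFormula.eval_odotIter (hq i ρ a b) (hr i ρ a b) 1⟩

theorem succ_nsmul (ht : IsExpressible p op t) (j : ℕ) :
    IsExpressible p op fun i a b => (j + 1) • t i a b := by
  induction j with
  | zero => simpa using ht
  | succ j ih => simpa only [_root_.succ_nsmul _ (j + 1)] using ih.add ht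

theorem zsmul {N : ℕ} (hN : N ≠ 0) (hG : ∀ y : G, N • y = 0) (ht : IsExpressible p op t) (c : ℤ) :
    IsExpressible p op fun i a b => c • t i a b := by
  -- The multiplier is replaced by a positive one, since formulas have neither `0` nor negation.
  obtain ⟨j, hj⟩ := Int.eq_ofNat_of_zero_le (Int.emod_nonneg (c - 1) (Int.natCast_ne_zero.mpr hN))
  have hc : c = ((j + 1 : ℕ) : ℤ) + (c - 1) / N * N := by
    have := Int.emod_add_ediv_mul (c - 1) N
    push_cast
    linarith
  have h : ∀ y : G, c • y = (j + 1) • y := fun y => by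
    rw [hc, add_smul, mul_smul, natCast_zsmul, natCast_zsmul, hG, smul_zero, add_zero]
  simpa only [h] using ht.succ_nsmul j

/-- If the operations of `s i a b` through `op i` are given by endomorphisms with a divisible
`m`-th power, then the quotients of their `2 * m`-th powers by `p` are expressible: the `m`
applications after the division remove the ambiguity of the pullback function. -/
theorem quot {m : ℕ} {L : ι → G → G → Module.End ℤ G} (hL : ∀ i a b, IsShort p m (L i a b))
    (hs : IsExpressible p op s) (hop : ∀ i a b y, op i (s i a b) y = L i a b y)
    (ht : IsExpressible p op t) : IsExpressible p op fun i a b => (hL i a b).quot (t i a b) := by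
  obtain ⟨q, hq⟩ := hs
  obtain ⟨r, hr⟩ := ht
  refine ⟨.odotIter q (.pull (.odotIter q r m)) m, fun i ρ a b => ?_⟩
  have hiter : ∀ y, (op i (s i a b))^[m] y = (L i a b ^ m) y := fun y => by
    rw [Module.End.pow_apply, ← funext (hop i a b)]
  have h₁ := BraceFormula.eval_odotIter (hq i ρ a b) (hr i ρ a b) m
  rw [hiter] at h₁
  have h₂ := BraceFormula.eval_pull h₁ ((hL i a b).exists_smul_eq _)
  rw [BraceFormula.eval_odotIter (hq i ρ a b) h₂ m, hiter]
  exact congrArg some ((hL i a b).quot_apply (ρ.smul_toFun ⟨_, _⟩)).symm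

theorem eval {m N : ℕ} {L : ι → G → G → Module.End ℤ G} (hN : N ≠ 0) (hG : ∀ y : G, N • y = 0)
    (hL : ∀ i a b, IsShort p m (L i a b)) (hs : IsExpressible p op s)
    (hop : ∀ i a b y, op i (s i a b) y = L i a b y) (ht : IsExpressible p op t)
    (F : MvPolynomial (Fin 2) ℤ) :
    IsExpressible p op fun i a b => (hL i a b).eval F (t i a b) := by
  induction F using MvPolynomial.induction_on generalizing t with
  | C c =>
    simpa [← MvPolynomial.algebraMap_eq] using ht.zsmul hN hG c
  | add F F' hF hF' => simpa using (hF ht).add (hF' ht)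
  | mul_X F j hF =>
    have hX : IsExpressible p op fun i a b => (hL i a b).eval (.X j) (t i a b) := by
      fin_cases j
      · simpa [hop] using hs.odot ht
      · simpa using quot hL hs hop ht
    simpa using hF hX

theorem iterate {f : ι → G → G}
    (hf : ∀ t, IsExpressible p op t → IsExpressible p op fun i a b => f i (t i a b))
    (ht : IsExpressible p op t) (j : ℕ) :
    IsExpressible p op fun i a b => (f i)^[j] (t i a b) := by
  induction j with
  | zero => exact ht
  | succ j ih => simpa only [Function.iterate_succ_apply'] using hf _ ih

/-- If `U(L x) x ⊙ y = (L x · U(L x)) y`, then `L x y` can be expressed through `⊙`. The map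
`g x = U(L x) x` is bijective. The endomorphism `L x` is a polynomial in the operation of `g x`, and
so is the inverse of `U(L x)`, which makes the inverse of `g` expressible. On a finite set `g` is a
power of its inverse, hence expressible as well. -/
theorem of_eval_odot [Finite G] {m n : ℕ} (hp : p ≠ 0) (hn : ∀ y : G, p ^ n • y = 0)
    {U : MvPolynomial (Fin 2) ℤ} (hU : U - 1 ∈ augIdeal) {L : ι → G → Module.End ℤ G}
    (hL : ∀ i x, IsShort p m (L i x))
    (hop : ∀ i x y, op i ((hL i x).eval U x) y = (hL i x).eval (.X 0 * U) y) :
    IsExpressible p op fun i a b => L i a b := by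
  obtain ⟨N, hN⟩ := exists_augIdeal_pow_le (m * n) n
  obtain ⟨V, hV⟩ := exists_mul_sub_one_mem hU N
  obtain ⟨V', hV'⟩ := exists_substHom_sub_mem (m := m) hU V N
  obtain ⟨H, hH⟩ := exists_substHom_sub_mem (m := m) hU (.X 0) N
  have hinj : ∀ i, Function.Injective fun x => (hL i x).eval U x := fun i x y hxy => by
    refine IsShort.eq_of_eval_apply_eq (hL i x) (hL i y) hn hU (LinearMap.ext fun z => ?_) hxy
    rw [← hop, ← hop]
    exact congrArg (fun w => op i w z) hxy
  let g : ι → Equiv.Perm G := fun i =>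
    Equiv.ofBijective _ (Finite.injective_iff_bijective.mp (hinj i))
  have hsubst : ∀ i x F F', F - substHom m U F' ∈ augIdeal ^ N →
      (hL i x).eval F = ((hL i x).eval_X_mul U).eval F' := fun i x F F' hF => by
    have := (hL i x).eval_eq_zero_of_mem hn hN hF
    rwa [map_sub, sub_eq_zero, IsShort.eval_substHom] at this
  have hop' : ∀ i x y, op i x y = (hL i ((g i).symm x)).eval (.X 0 * U) y := fun i x y => by
    rw [← hop]
    exact congrArg (fun z => op i z y) ((g i).apply_symm_apply x).symm
  -- `(g i).symm x` is the inverse of `U(L)` applied to `x`, hence the value at `x` of a polynomial in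
  -- the operation of `x`.
  have hsymm : ∀ t, IsExpressible p op t →
      IsExpressible p op fun i a b => (g i).symm (t i a b) := fun t ht => by
    have heq : ∀ i x, (g i).symm x =
        ((hL i ((g i).symm x)).eval_X_mul U).eval V' x := fun i x => by
      rw [← hsubst i _ V V' hV']
      have := (hL i ((g i).symm x)).eval_apply_eval_of_mul_sub_one_mem hn hN hV ((g i).symm x)
      exact this.symm.trans (congrArg _ ((g i).apply_symm_apply x))
    have := eval (pow_ne_zero n hp) hn
      (fun i a b => (hL i ((g i).symm (t i a b))).eval_X_mul U) ht (fun i a b y => hop' i _ y) ht V'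
    simpa only [← heq] using this
  have hg : IsExpressible p op fun i a _ => g i a := by
    -- The exponent must not depend on `i`; the order of the symmetric group serves for all `i`.
    have hpow : ∀ i x, (g i).symm^[Nat.card (Equiv.Perm G) - 1] x = g i x := fun i x => by
      have h1 : (g i).symm ^ (Nat.card (Equiv.Perm G) - 1) = g i := by
        have h2 : (g i).symm ^ (Nat.card (Equiv.Perm G) - 1) * (g i).symm = 1 := by
          rw [← pow_succ, Nat.sub_add_cancel Nat.card_pos, pow_card_eq_one']
        exact (eq_inv_of_mul_eq_one_left h2).trans (inv_inv (g i))
      rw [Equiv.Perm.iterate_eq_pow, h1]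
    simpa only [hpow] using iterate hsymm fst (Nat.card (Equiv.Perm G) - 1)
  have := eval (pow_ne_zero n hp) hn (fun i a _ => (hL i a).eval_X_mul U) hg
    (fun i a _ y => hop i a y) snd H
  simpa only [← hsubst _ _ _ _ hH, IsShort.eval_X_zero] using this

end IsExpressible

/-! ### The factor brace from the brace of multiples -/

/-- The operation `⊙` on `A / ann(p ^ (2 * k))`, together with the relation from which the factor
brace is recovered: if the `p ^ k`-th power of `x` is `p ^ k g`, then `g ⊙ y` is the value at `y` of
the endomorphism `((1 + L) ^ (p ^ k) - 1) / p ^ k`, where `L y = x * y`. -/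
theorem LeftBrace.HasDivisiblePowers.exists_isOdot {A : Type*} [AddCommGroup A] [Finite A]
    {B : LeftBrace A} {p m n k : ℕ} {U : MvPolynomial (Fin 2) ℤ}
    (hB : B.HasDivisiblePowers p m) (hn : ∀ y : A, p ^ n • y = 0) (hU : U - 1 ∈ augIdeal)
    (hUk : IsPowPoly p m k U) (hI : B.IsIdeal (annihilated A (p ^ (2 * k))))
    (hJ : B.IsIdeal (multiples A (p ^ k))) :
    ∃ op : A ⧸ annihilated A (p ^ (2 * k)) → A ⧸ annihilated A (p ^ (2 * k)) →
        A ⧸ annihilated A (p ^ (2 * k)),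
      B.IsOdot p k op ∧
      LeftBrace.IsOdotOfMultiples p k (B.restrict (multiples A (p ^ k)) hJ) op ∧
      ∀ x y, op ((hB.isShort_factor hI x).eval U x) y =
        (hB.isShort_factor hI x).eval (.X 0 * U) y := by
  have hpow : p ^ (2 * k) = p ^ k * p ^ k := by rw [two_mul, pow_add]
  obtain ⟨op, hop⟩ := hB.exists_odot hn hU hUk
  refine ⟨op, fun w x y => ?_, fun w x y => ?_, fun x y => ?_⟩
  · obtain ⟨E, hE⟩ := hB.exists_smul_eq_star hn hU hUk x
    have h : B.star (p ^ k • x) y ∈ multiples A (p ^ k) := ⟨E y, (hE y).symm⟩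
    refine ⟨h, hop x y _ ?_⟩
    rw [hpow, mul_smul, w.smul_toFun ⟨_, h⟩]
    exact (map_nsmul (B.starHom (p ^ k • x)) (p ^ k) y).symm
  · obtain ⟨E, hE⟩ := hB.exists_smul_eq_star hn hU hUk x
    have h : B.star (p ^ k • x) (p ^ k • y) ∈ multiples A (p ^ (2 * k)) :=
      ⟨E y, by rw [hE, map_nsmul, hpow, mul_smul]⟩
    exact ⟨h, hop x y _ (w.smul_toFun ⟨_, h⟩)⟩
  · obtain ⟨a, rfl⟩ := QuotientAddGroup.mk_surjective x
    obtain ⟨b, rfl⟩ := QuotientAddGroup.mk_surjective y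
    rw [← hB.mk_eval hI, ← hB.mk_eval hI]
    refine hop _ _ _ ?_
    rw [hB.star_smul_eval hUk, map_nsmul, ← mul_smul, hpow]

theorem mainTheorem1 (p n k : ℕ) (hp : p.Prime) (A : Type*) [AddCommGroup A]
    (hA : Nat.card A = p ^ n) :
    ∃ q : BraceFormula, ∀ B : LeftBrace A, B.HasShortProducts p →
      ∃ (hI : B.IsIdeal (annihilated A (p ^ (2 * k))))
        (hJ : B.IsIdeal (multiples A (p ^ k)))
        (op : A ⧸ annihilated A (p ^ (2 * k)) → A ⧸ annihilated A (p ^ (2 * k)) →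
          A ⧸ annihilated A (p ^ (2 * k))),
        B.IsOdot p k op ∧
        LeftBrace.IsOdotOfMultiples p k (B.restrict (multiples A (p ^ k)) hJ) op ∧
        ∀ (ρ : Pullback (A ⧸ annihilated A (p ^ (2 * k))) p)
          (a b : A ⧸ annihilated A (p ^ (2 * k))),
          q.eval op ρ a b = some ((B.factor (annihilated A (p ^ (2 * k))) hI).star a b) := by
  have : Finite A := Nat.finite_of_card_ne_zero (hA ▸ pow_ne_zero n hp.ne_zero)
  have hn : ∀ y : A, p ^ n • y = 0 := fun y => hA ▸ card_nsmul_eq_zero'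
  have hm : 2 * ((p - 2) / 4) ≤ p - 1 := by omega
  obtain ⟨U, hU, hUk⟩ := exists_isPowPoly hp hm k
  obtain ⟨U₂, hU₂, hUk₂⟩ := exists_isPowPoly hp hm (2 * k)
  have hB : ∀ B : {B : LeftBrace A // B.HasShortProducts p},
      B.1.HasDivisiblePowers p ((p - 2) / 4) := fun B => B.2.hasDivisiblePowers
  have hI := fun B => (hB B).isIdeal_annihilated hn hU₂ hUk₂
  have hJ := fun B => (hB B).isIdeal_multiples hn hU hUk
  choose op hodot hodot' hop using fun B => (hB B).exists_isOdot hn hU hUk (hI B) (hJ B)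
  obtain ⟨q, hq⟩ := IsExpressible.of_eval_odot (p := p) hp.ne_zero
    (fun y : A ⧸ annihilated A (p ^ (2 * k)) => by
      obtain ⟨y, rfl⟩ := QuotientAddGroup.mk_surjective y
      exact congrArg _ (hn y)) hU (fun B => (hB B).isShort_factor (hI B)) hop
  exact ⟨q, fun B h => ⟨hI ⟨B, h⟩, hJ ⟨B, h⟩, op ⟨B, h⟩, hodot ⟨B, h⟩, hodot' ⟨B, h⟩, hq ⟨B, h⟩⟩⟩
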